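/- Lemma 3. Let $\Omega\subset\mathbb R^2$ be a polygonal domain with a finite conforming triangulation $\tau_h$ (closed nondegenerate triangles $K$ that fill $\overline\Omega$, any two of which are disjoint or meet in a common vertex or a common edge), with set of edges $\varepsilon^h$. Let $h_K$ be the diameter of $K$, $|e|$ the length of an edge $e$, and $\tau_e$ the set of the triangles of $\tau_h$ that have $e$ as an edge ($e$ is an interior edge if $\tau_e$ has two elements, a boundary edge if it has one). The chunkiness parameter of $K$ is $h_K/\rho_K$, where $\rho_K$ is the supremum of the radii of the balls with respect to which $K$ is star-shaped. Let $V_h=V_h^1+V_h^2$ be the NC1-C2 space. Here $V_h^1$ consists of the $v\in L^2(\Omega)$ such that $v|_K$ is affine for every $K\in\tau_h$ and $v$ is continuous at the midpoints of the interior edges, and $V_h^2$ consists of the $v\in L^2(\Omega)$ such that $v|_K\in D_K^2$ for every $K\in\tau_h$, where $D^2_K$ is spanned by the functions $\hat\phi_i\circ F_K^{-1}$, $i=1,2,3$, $F_K$ is an affine map of the reference triangle with vertices $(0,0),(1,0),(0,1)$ onto $K$, and $$\hat\phi_1=(-1+2x+2y)(-1+x+y),\qquad \hat\phi_2=(2x-1)x,\qquad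 \hat\phi_3=(2y-1)y .$$ Let $V_{h,0}=V_{h,0}^1+V_h^2$, where $V_{h,0}^1$ is the subspace of those $v\in V_h^1$ that vanish at the midpoints of the boundary edges. For $\omega\in V_h$ the jump across $e$ is the function $[\omega]=\sum_{K\in\tau_e}\omega|_K\,\mathbf n_K$ on $e$, where $\omega|_K$ is extended continuously to the closed triangle $K$ and $\mathbf n_K$ is the unit normal of $e$ that points out of $K$. For every $\gamma$ there is a constant $C>0$, depending only on $\gamma$, such that for every such $\Omega$ and $\tau_h$, every edge $e\in\varepsilon^h$ such that the chunkiness parameter of each $K\in\tau_e$ is at most $\gamma$, and every $\omega$, where either $\omega\in V_h$ and $e$ is an interior edge, or $\omega\in V_{h,0}$ and $e$ is an arbitrary edge, the jump $[\omega]$ vanishes at the midpoint of $e$ and $$|e|\,\|[\omega]\|_{L^2(e)}^2\le C\sum_{K\in\tau_e}h_K^2\,|\omega|_{H^1(K)}^2 .$$ -/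

import Mathlib

open MeasureTheory

noncomputable section

namespace NC1C2

/-- The Euclidean plane. -/
abbrev Plane := EuclideanSpace ℝ (Fin 2)

/-- The closed triangle (or segment) with vertex set `s`. -/
def hull (s : Finset Plane) : Set Plane := convexHull ℝ (s : Set Plane)

/-- A conforming triangulation of the polygonal domain `Ω`: a finite simplicial complex in the
plane (so two triangles that meet do so in a common vertex or a common edge), every face of which
lies in a triangle, and whose triangles fill `Ω`, that is, `Ω` is the interior of their union. -/
structure Triangulation (Ω : Set Plane) where
  complex : Geometry.SimplicialComplex ℝ Plane
  finite : complex.faces.Finite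
  pure : ∀ s ∈ complex.faces, ∃ t ∈ complex.faces, s ⊆ t ∧ t.card = 3
  fills : interior complex.space = Ω

/-- The diameter `h_K`. -/
def diameter (K : Finset Plane) : ℝ := Metric.diam (hull K)

/-- `A` is star-shaped with respect to the ball `B`. -/
def StarShapedWrt (A B : Set Plane) : Prop := ∀ x ∈ A, convexHull ℝ (insert x B) ⊆ A

/-- The chunkiness parameter of `K`: the diameter of `K` divided by the supremum of the radii of
the balls with respect to which `K` is star-shaped. -/
def chunkiness (K : Finset Plane) : ℝ :=
  diameter K / sSup {ρ : ℝ | 0 < ρ ∧ ∃ x, Metric.ball x ρ ⊆ hull K ∧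
    StarShapedWrt (hull K) (Metric.ball x ρ)}

/-- The length `|e|`. -/
def edgeLength (e : Finset Plane) : ℝ := (Measure.hausdorffMeasure 1 : Measure Plane).real (hull e)

/-- The midpoint of the edge `e` (used for `e` with two elements). -/
def edgeMidpoint (e : Finset Plane) : Plane := (2⁻¹ : ℝ) • ∑ x ∈ e, x

/-- `n` is the unit normal of the edge `e` of `K` pointing towards the outside of `K`. -/
def IsOutwardNormal (K e : Finset Plane) (n : Plane) : Prop :=
  ‖n‖ = 1 ∧ (∀ x ∈ e, ∀ y ∈ e, inner ℝ n (y - x) = 0) ∧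
    ∀ x ∈ e, ∀ z ∈ K \ e, inner ℝ n (z - x) < 0

/-- The unit outward normal of the edge `e` of the triangle `K`. -/
def outwardNormal (K e : Finset Plane) : Plane := Classical.epsilon (IsOutwardNormal K e)

/-- The basis functions of the reference triangle with vertices `(0,0)`, `(1,0)`, `(0,1)`. -/
def refBasis : Fin 3 → Plane → ℝ :=
  ![fun z => (-1 + 2 * z 0 + 2 * z 1) * (-1 + z 0 + z 1),
    fun z => (2 * z 0 - 1) * z 0,
    fun z => (2 * z 1 - 1) * z 1]

/-- The affine map `F_K` that takes the vertices of the reference triangle to `b 0`, `b 1`, `b 2`. -/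
def refMap (b : Fin 3 → Plane) (z : Plane) : Plane :=
  b 0 + z 0 • (b 1 - b 0) + z 1 • (b 2 - b 0)

/-- The space `D_K^2` spanned by the functions `refBasis i ∘ (refMap b)⁻¹`, for the triangle `K`
with vertices `b 0`, `b 1`, `b 2`; as `refMap b` is a bijection, these are the functions whose
composition with `refMap b` lies in the span of the `refBasis i`. The space does not depend on the
order of the vertices. -/
def quadraticBumps (b : Fin 3 → Plane) : Submodule ℝ (Plane → ℝ) :=
  (Submodule.span ℝ (Set.range refBasis)).comap (LinearMap.funLeft ℝ ℝ (refMap b))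

/-- The function `f`, defined almost everywhere on `Ω`, restricts to `p` on the triangle `K`. -/
def RestrictsTo (Ω : Set Plane) (f : Plane → ℝ) (K : Finset Plane) (p : Plane → ℝ) : Prop :=
  ∀ᵐ x ∂(volume.restrict Ω), x ∈ hull K → f x = p x

open Classical in
/-- The restriction `f|_K` as a continuous function on the closed triangle `K`. Its values on `K`
are determined by `f`; only these are used. -/
def restr (Ω : Set Plane) (f : Plane → ℝ) (K : Finset Plane) : Plane → ℝ :=
  if h : ∃ p, ContinuousOn p (hull K) ∧ RestrictsTo Ω f K p then h.choose else 0

/-- The squared seminorm `|f|²_{H¹(K)}` of a function that is smooth on the open triangle. -/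
def h1SeminormSq (Ω : Set Plane) (f : Plane → ℝ) (K : Finset Plane) : ℝ :=
  ∫ x in interior (hull K), ‖gradient (restr Ω f K) x‖ ^ 2

namespace Triangulation

variable {Ω : Set Plane} (T : Triangulation Ω)

open Classical in
/-- The triangles of the triangulation, each given by its set of vertices. -/
def triangles : Finset (Finset Plane) := {K ∈ T.finite.toFinset | K.card = 3}

open Classical in
/-- The edges of the triangulation, each given by its set of end points. -/
def edges : Finset (Finset Plane) := {e ∈ T.finite.toFinset | e.card = 2}

open Classical in
/-- The triangles that have `e` as an edge. -/
def trianglesAt (e : Finset Plane) : Finset (Finset Plane) := {K ∈ T.triangles | e ⊆ K}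

/-- An interior edge: one shared by two triangles. -/
def IsInteriorEdge (e : Finset Plane) : Prop := e ∈ T.edges ∧ (T.trianglesAt e).card = 2

/-- A boundary edge: one that belongs to a single triangle. -/
def IsBoundaryEdge (e : Finset Plane) : Prop := e ∈ T.edges ∧ (T.trianglesAt e).card = 1

/-- The jump across `e`: `f|_{K₁} n₁ + f|_{K₂} n₂` if `e` is shared by `K₁` and `K₂`, and `f|_K n`
if `e` is a boundary edge that belongs to `K`. -/
def jump (f : Plane → ℝ) (e : Finset Plane) (x : Plane) : Plane :=
  ∑ K ∈ T.trianglesAt e, restr Ω f K x • outwardNormal K e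

/-- `‖[f]‖²_{L²(e)}`, the integral being with respect to arc length. -/
def jumpNormSq (f : Plane → ℝ) (e : Finset Plane) : ℝ :=
  ∫ x in hull e, ‖T.jump f e x‖ ^ 2 ∂(Measure.hausdorffMeasure 1)

/-- The `P₁` nonconforming space `V_h^1`: affine on every triangle, continuous at the midpoints of
the edges. -/
def V1 : Submodule ℝ (Lp ℝ 2 (volume.restrict Ω)) where
  carrier := {v | ∃ a : Finset Plane → (Plane →ᵃ[ℝ] ℝ),
    (∀ K ∈ T.triangles, RestrictsTo Ω v K (a K)) ∧
    ∀ e ∈ T.edges, ∀ K ∈ T.trianglesAt e, ∀ K' ∈ T.trianglesAt e,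
      a K (edgeMidpoint e) = a K' (edgeMidpoint e)}
  zero_mem' := by
    refine ⟨0, fun K _ => ?_, fun _ _ _ _ _ _ => rfl⟩
    filter_upwards [Lp.coeFn_zero ℝ 2 (volume.restrict Ω)] with x hx _
    rw [hx]; rfl
  add_mem' := by
    rintro v w ⟨a, ha, ha'⟩ ⟨b, hb, hb'⟩
    refine ⟨a + b, fun K hK => ?_, fun e he K hK K' hK' => ?_⟩
    · filter_upwards [Lp.coeFn_add v w, ha K hK, hb K hK] with x hx h1 h2 hxK
      rw [hx, Pi.add_apply, h1 hxK, h2 hxK]; rfl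
    · simp [ha' e he K hK K' hK', hb' e he K hK K' hK']
  smul_mem' := by
    rintro c v ⟨a, ha, ha'⟩
    refine ⟨c • a, fun K hK => ?_, fun e he K hK K' hK' => ?_⟩
    · filter_upwards [Lp.coeFn_smul c v, ha K hK] with x hx h1 hxK
      rw [hx, Pi.smul_apply, h1 hxK]; rfl
    · simp [ha' e he K hK K' hK']

/-- The subspace of `V_h^1` of the functions that vanish at the midpoints of the boundary edges. -/
def V1zero : Submodule ℝ (Lp ℝ 2 (volume.restrict Ω)) where
  carrier := {v | v ∈ T.V1 ∧ ∃ a : Finset Plane → (Plane →ᵃ[ℝ] ℝ),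
    (∀ K ∈ T.triangles, RestrictsTo Ω v K (a K)) ∧
    ∀ e, T.IsBoundaryEdge e → ∀ K ∈ T.trianglesAt e, a K (edgeMidpoint e) = 0}
  zero_mem' := by
    refine ⟨T.V1.zero_mem, 0, fun K _ => ?_, fun _ _ _ _ => rfl⟩
    filter_upwards [Lp.coeFn_zero ℝ 2 (volume.restrict Ω)] with x hx _
    rw [hx]; rfl
  add_mem' := by
    rintro v w ⟨hv, a, ha, ha'⟩ ⟨hw, b, hb, hb'⟩
    refine ⟨T.V1.add_mem hv hw, a + b, fun K hK => ?_, fun e he K hK => ?_⟩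
    · filter_upwards [Lp.coeFn_add v w, ha K hK, hb K hK] with x hx h1 h2 hxK
      rw [hx, Pi.add_apply, h1 hxK, h2 hxK]; rfl
    · simp [ha' e he K hK, hb' e he K hK]
  smul_mem' := by
    rintro c v ⟨hv, a, ha, ha'⟩
    refine ⟨T.V1.smul_mem c hv, c • a, fun K hK => ?_, fun e he K hK => ?_⟩
    · filter_upwards [Lp.coeFn_smul c v, ha K hK] with x hx h1 hxK
      rw [hx, Pi.smul_apply, h1 hxK]; rfl
    · simp [ha' e he K hK]

/-- The space `V_h^2` of the functions whose restriction to every triangle `K` lies in `D_K^2`. -/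
def V2 : Submodule ℝ (Lp ℝ 2 (volume.restrict Ω)) where
  carrier := {v | ∀ K ∈ T.triangles, ∀ b : Fin 3 → Plane, Set.range b = (K : Set Plane) →
    ∃ q ∈ quadraticBumps b, RestrictsTo Ω v K q}
  zero_mem' := by
    refine fun K _ b _ => ⟨0, Submodule.zero_mem _, ?_⟩
    filter_upwards [Lp.coeFn_zero ℝ 2 (volume.restrict Ω)] with x hx _
    rw [hx]
  add_mem' := by
    intro v w hv hw K hK b hb
    obtain ⟨p, hp, hp'⟩ := hv K hK b hb
    obtain ⟨q, hq, hq'⟩ := hw K hK b hb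
    refine ⟨p + q, Submodule.add_mem _ hp hq, ?_⟩
    filter_upwards [Lp.coeFn_add v w, hp', hq'] with x hx h1 h2 hxK
    rw [hx, Pi.add_apply, h1 hxK, h2 hxK]; rfl
  smul_mem' := by
    intro c v hv K hK b hb
    obtain ⟨p, hp, hp'⟩ := hv K hK b hb
    refine ⟨c • p, Submodule.smul_mem _ c hp, ?_⟩
    filter_upwards [Lp.coeFn_smul c v, hp'] with x hx h1 hxK
    rw [hx, Pi.smul_apply, h1 hxK]; rfl

/-- The NC1-C2 space `V_h = V_h^1 + V_h^2`. -/
def Vh : Submodule ℝ (Lp ℝ 2 (volume.restrict Ω)) := T.V1 ⊔ T.V2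

/-- The NC1-C2 space with homogeneous Dirichlet condition: its functions vanish at the midpoints of
the boundary edges (those of `V_h^2` vanish at all edge midpoints). -/
def VhZero : Submodule ℝ (Lp ℝ 2 (volume.restrict Ω)) := T.V1zero ⊔ T.V2

end Triangulation

end NC1C2

end

/-! At the midpoint m of e the functions of D_K^2 vanish, so only the affine parts count. On an
interior edge these agree at m and the two outward normals are opposite; on a boundary edge the
affine part is zero at m. Hence [ω](m) = 0 and [ω](x) = ∑ (ω|_K(x) - ω|_K(m)) n_K.

It remains to bound the oscillation of ω|_K by its H¹ seminorm
(`sq_sub_le_integral_of_hasAffineGradient`). As ω|_K is quadratic, its gradient is affine, and the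
maximum of an affine field on a convex set is controlled by its L² mean
(`volume_mul_norm_sq_le_integral`); the mean value inequality then costs a factor h_K², which the
chunkiness bound absorbs into the area. Integrating over e and using |e| ≤ h_K finishes the
estimate.

The geometric input is `exists_side`: distinct triangles at an edge lie on opposite sides of it, so
there are at most two and their normals cancel. -/

namespace NC1C2

/-! ### Maximum of an affine field against its L² norm -/

/-- An affine map on a compact convex set is bounded by its `L²` norm on the interior. -/
theorem volume_mul_norm_sq_le_integral {s : Set Plane} (hs : Convex ℝ s) (hc : IsCompact s)
    (g : Plane →ᵃ[ℝ] Plane) {x : Plane} (hx : x ∈ s) :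
    volume.real (interior s) * ‖g x‖ ^ 2 ≤ 64 * ∫ y in interior s, ‖g y‖ ^ 2 := by
  have hg : Continuous g := g.continuous_of_finiteDimensional
  obtain ⟨v, hv, hmax⟩ := hc.exists_isMaxOn ⟨x, hx⟩ hg.norm.continuousOn
  have hmax' : ∀ y ∈ s, ‖g y‖ ≤ ‖g v‖ := fun y hy => hmax hy
  have hint : IntegrableOn (fun y => ‖g y‖ ^ 2) (interior s) :=
    ((hg.norm.pow 2).continuousOn.integrableOn_compact hc).mono_set interior_subset
  -- Shrink towards the maximum point `v` by the ratio 1/4. There `g` differs from `g v` by a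
  -- quarter of `g v - g y`, hence by at most `‖g v‖ / 2`, so `‖g‖ ^ 2` is at least `‖g v‖ ^ 2 / 4`
  -- on `S`. The area of `S` is 1/16 of the total, and 64 = 4 · 16.
  set S := AffineMap.homothety v (1 / 4 : ℝ) '' interior s with hS
  have hSs : S ⊆ interior s := by
    rintro _ ⟨y, hy, rfl⟩
    have := hs.add_smul_sub_mem_interior hv hy (t := (1 / 4 : ℝ)) ⟨by norm_num, by norm_num⟩
    simpa [AffineMap.homothety_apply, add_comm] using this
  have hlow : ∀ y ∈ S, ‖g v‖ ^ 2 / 4 ≤ ‖g y‖ ^ 2 := by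
    rintro _ ⟨y, hy, rfl⟩
    have h1 : g (AffineMap.homothety v (1 / 4 : ℝ) y) = g v - (1 / 4 : ℝ) • (g v - g y) := by
      rw [AffineMap.homothety_eq_lineMap, AffineMap.apply_lineMap, AffineMap.lineMap_apply]
      simp only [vsub_eq_sub, vadd_eq_add, smul_sub]
      abel
    have h2 := norm_sub_norm_le (g v) ((1 / 4 : ℝ) • (g v - g y))
    have h3 : ‖(1 / 4 : ℝ) • (g v - g y)‖ ≤ ‖g v‖ / 2 := by
      rw [norm_smul, Real.norm_of_nonneg (by norm_num)]
      linarith [norm_sub_le (g v) (g y), hmax' y (interior_subset hy)]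
    rw [h1]
    nlinarith [norm_nonneg (g v)]
  have hSmeas : MeasurableSet S := by
    have : IsOpen S := AffineMap.homothety_isOpenMap v (1 / 4 : ℝ) (by norm_num) _ isOpen_interior
    exact this.measurableSet
  have hfin : volume S ≠ ⊤ :=
    ((measure_mono (hSs.trans interior_subset)).trans_lt hc.measure_lt_top).ne
  have hvol : volume.real S = volume.real (interior s) / 16 := by
    rw [measureReal_def, hS, Measure.addHaar_image_homothety, ENNReal.toReal_mul,
      ENNReal.toReal_ofReal (abs_nonneg _), finrank_euclideanSpace_fin, measureReal_def]
    norm_num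
    ring
  have hSint : volume.real S * (‖g v‖ ^ 2 / 4) ≤ ∫ y in S, ‖g y‖ ^ 2 := by
    have := setIntegral_mono_on (μ := volume) (s := S) (f := fun _ => ‖g v‖ ^ 2 / 4)
      (g := fun y => ‖g y‖ ^ 2) (integrableOn_const hfin) (hint.mono_set hSs) hSmeas hlow
    simpa using this
  have hle : ∫ y in S, ‖g y‖ ^ 2 ≤ ∫ y in interior s, ‖g y‖ ^ 2 :=
    setIntegral_mono_set hint (ae_of_all _ fun y => by positivity) hSs.eventuallyLE
  have hxv : ‖g x‖ ^ 2 ≤ ‖g v‖ ^ 2 := pow_le_pow_left₀ (norm_nonneg _) (hmax' x hx) 2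
  have := mul_le_mul_of_nonneg_left hxv (measureReal_nonneg (μ := volume) (s := interior s))
  rw [hvol] at hSint
  linarith

/-! ### Quadratic polynomials -/

/-- `w` has an affine gradient field, that is, `w` is a polynomial of degree at most two. -/
def HasAffineGradient (w : Plane → ℝ) : Prop :=
  ∃ g : Plane →ᵃ[ℝ] Plane, ∀ x, HasGradientAt w (g x) x

theorem HasAffineGradient.continuous {w : Plane → ℝ} (hw : HasAffineGradient w) :
    Continuous w := by
  obtain ⟨g, hg⟩ := hw
  exact continuous_iff_continuousAt.2 fun x => (hg x).continuousAt

theorem HasAffineGradient.add {v w : Plane → ℝ} (hv : HasAffineGradient v)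
    (hw : HasAffineGradient w) : HasAffineGradient (v + w) := by
  obtain ⟨g, hg⟩ := hv
  obtain ⟨k, hk⟩ := hw
  refine ⟨g + k, fun x => ?_⟩
  have := (hg x).hasFDerivAt.add (hk x).hasFDerivAt
  rw [hasGradientAt_iff_hasFDerivAt]
  simpa using this

theorem HasAffineGradient.const_smul {w : Plane → ℝ} (c : ℝ) (hw : HasAffineGradient w) :
    HasAffineGradient (c • w) := by
  obtain ⟨g, hg⟩ := hw
  refine ⟨c • g, fun x => ?_⟩
  have := (hg x).hasFDerivAt.const_smul c
  rw [hasGradientAt_iff_hasFDerivAt]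
  simpa using this

theorem exists_hasGradientAt_affineMap (a : Plane →ᵃ[ℝ] ℝ) :
    ∃ u : Plane, ∀ x, HasGradientAt a u x := by
  refine ⟨(InnerProductSpace.toDual ℝ Plane).symm (LinearMap.toContinuousLinearMap a.linear),
    fun x => ?_⟩
  rw [hasGradientAt_iff_hasFDerivAt, LinearIsometryEquiv.apply_symm_apply]
  have h : (a : Plane → ℝ) = fun y => LinearMap.toContinuousLinearMap a.linear y + a 0 := by
    ext y
    exact congrFun a.decomp y
  rw [h]
  exact (ContinuousLinearMap.hasFDerivAt _).add_const _

theorem hasAffineGradient_affineMap (a : Plane →ᵃ[ℝ] ℝ) : HasAffineGradient a := by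
  obtain ⟨u, hu⟩ := exists_hasGradientAt_affineMap a
  exact ⟨AffineMap.const ℝ Plane u, hu⟩

/-- By the product rule the gradient is `a x • v + b x • u` with constant `u` and `v`. -/
theorem hasAffineGradient_mul_affineMap (a b : Plane →ᵃ[ℝ] ℝ) :
    HasAffineGradient fun x => a x * b x := by
  obtain ⟨u, hu⟩ := exists_hasGradientAt_affineMap a
  obtain ⟨v, hv⟩ := exists_hasGradientAt_affineMap b
  refine ⟨(LinearMap.toSpanSingleton ℝ Plane v).toAffineMap.comp a +
    (LinearMap.toSpanSingleton ℝ Plane u).toAffineMap.comp b, fun x => ?_⟩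
  have := (hu x).hasFDerivAt.mul (hv x).hasFDerivAt
  rw [hasGradientAt_iff_hasFDerivAt]
  exact this.congr_fderiv (by simp)

/-! ### Diameter, chunkiness and oscillation on a triangle -/

theorem isCompact_hull (s : Finset Plane) : IsCompact (hull s) :=
  s.finite_toSet.isCompact_convexHull ℝ

theorem convex_hull (s : Finset Plane) : Convex ℝ (hull s) := convex_convexHull ℝ _

theorem interior_hull_nonempty {K : Finset Plane} (hK : K.card = 3)
    (hi : AffineIndependent ℝ ((↑) : K → Plane)) : (interior (hull K)).Nonempty := by
  rw [hull, interior_convexHull_nonempty_iff_affineSpan_eq_top]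
  have := hi.affineSpan_eq_top_iff_card_eq_finrank_add_one.2 (by simp [hK])
  simpa using this

/-- Bounds the set of radii in `chunkiness`, without which its real `sSup` would have the default
value 0. -/
theorem le_diameter_of_ball_subset {K : Finset Plane} {x : Plane} {ρ : ℝ} (hρ : 0 < ρ)
    (h : Metric.ball x ρ ⊆ hull K) : ρ ≤ diameter K := by
  refine le_of_forall_lt fun r hr => ?_
  obtain ⟨t, ht, ht'⟩ := exists_between (max_lt hr hρ)
  have htpos := (le_max_right r 0).trans_lt ht
  have hmem : x + t • EuclideanSpace.single (0 : Fin 2) (1 : ℝ) ∈ Metric.ball x ρ := by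
    simpa [norm_smul, abs_of_pos htpos] using ht'
  have := Metric.dist_le_diam_of_mem (isCompact_hull K).isBounded (h hmem)
    (h (Metric.mem_ball_self hρ))
  have h2 : dist (x + t • EuclideanSpace.single (0 : Fin 2) (1 : ℝ)) x = t := by
    simp [norm_smul, abs_of_pos htpos]
  rw [h2] at this
  exact ((le_max_left r 0).trans_lt ht).trans_le this

/-- The area of a triangle is controlled by its diameter and its chunkiness parameter. -/
theorem diameter_sq_le_of_chunkiness_le {K : Finset Plane} {γ : ℝ} (hK : K.card = 3)
    (hi : AffineIndependent ℝ ((↑) : K → Plane)) (hγ : chunkiness K ≤ γ) :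
    diameter K ^ 2 ≤ 4 * γ ^ 2 * volume.real (interior (hull K)) := by
  set R := {ρ : ℝ | 0 < ρ ∧ ∃ x, Metric.ball x ρ ⊆ hull K ∧
    StarShapedWrt (hull K) (Metric.ball x ρ)} with hR
  have hne : R.Nonempty := by
    obtain ⟨x, hx⟩ := interior_hull_nonempty hK hi
    obtain ⟨ρ, hρ, hb⟩ := Metric.isOpen_iff.1 isOpen_interior x hx
    -- A convex set is star-shaped with respect to every ball that it contains.
    refine ⟨ρ, hρ, x, hb.trans interior_subset, fun y hy => ?_⟩
    exact convexHull_min (Set.insert_subset hy (hb.trans interior_subset)) (convex_hull K)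
  have hbdd : BddAbove R := ⟨diameter K, fun ρ ⟨h0, x, hx, _⟩ => le_diameter_of_ball_subset h0 hx⟩
  have hpos : 0 < sSup R := by
    obtain ⟨ρ, hρ⟩ := hne
    exact hρ.1.trans_le (le_csSup hbdd hρ)
  -- A radius above half the supremum avoids asking whether the supremum is attained; the lost
  -- factor 2 becomes the 4 in the bound. The area of the ball is at least ρ², as π > 1.
  obtain ⟨ρ, ⟨hρ, x, hx, -⟩, hlt⟩ := exists_lt_of_lt_csSup hne (half_lt_self hpos)
  have hd : diameter K ≤ γ * sSup R := (div_le_iff₀ hpos).1 hγ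
  have hd0 : 0 ≤ diameter K := Metric.diam_nonneg
  have hγ0 : 0 ≤ γ := by
    by_contra! h
    nlinarith
  have hd2 : diameter K ≤ γ * (2 * ρ) :=
    hd.trans (mul_le_mul_of_nonneg_left (by linarith) hγ0)
  have hvol : ρ ^ 2 ≤ volume.real (interior (hull K)) := by
    have h1 : volume.real (Metric.ball x ρ) ≤ volume.real (interior (hull K)) :=
      measureReal_mono (interior_maximal hx Metric.isOpen_ball)
        ((measure_mono interior_subset).trans_lt (isCompact_hull K).measure_lt_top).ne
    rw [measureReal_def, EuclideanSpace.volume_ball_fin_two, ENNReal.toReal_mul,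
      ENNReal.toReal_pow, ENNReal.toReal_ofReal hρ.le, ENNReal.toReal_ofReal Real.pi_pos.le] at h1
    nlinarith [Real.pi_gt_three, sq_nonneg ρ]
  calc diameter K ^ 2 ≤ (γ * (2 * ρ)) ^ 2 := pow_le_pow_left₀ hd0 hd2 2
    _ = 4 * γ ^ 2 * ρ ^ 2 := by ring
    _ ≤ _ := mul_le_mul_of_nonneg_left hvol (by positivity)

/-- The oscillation of a quadratic polynomial on a triangle is bounded by its `H¹` seminorm. -/
theorem sq_sub_le_integral_of_hasAffineGradient {K : Finset Plane} {γ : ℝ} (hK : K.card = 3)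
    (hi : AffineIndependent ℝ ((↑) : K → Plane)) (hγ : chunkiness K ≤ γ) {w : Plane → ℝ}
    (hw : HasAffineGradient w) {x y : Plane} (hx : x ∈ hull K) (hy : y ∈ hull K) :
    (w x - w y) ^ 2 ≤ 256 * γ ^ 2 * ∫ z in interior (hull K), ‖gradient w z‖ ^ 2 := by
  obtain ⟨g, hg⟩ := hw
  have hgrad : gradient w = g := gradient_eq hg
  rw [hgrad]
  have hgc : Continuous g := g.continuous_of_finiteDimensional
  obtain ⟨v, hv, hmax⟩ := (isCompact_hull K).exists_isMaxOn ⟨x, hx⟩ hgc.norm.continuousOn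
  have h1 := (convex_hull K).norm_image_sub_le_of_norm_hasFDerivWithin_le
    (f := w) (C := ‖g v‖) (fun z _ => (hg z).hasFDerivAt.hasFDerivWithinAt)
    (fun z hz => by simpa using hmax hz) hy hx
  have h2 : ‖x - y‖ ≤ diameter K := by
    rw [← dist_eq_norm]
    exact Metric.dist_le_diam_of_mem (isCompact_hull K).isBounded hx hy
  have h3 : ‖w x - w y‖ ≤ ‖g v‖ * diameter K :=
    h1.trans (mul_le_mul_of_nonneg_left h2 (norm_nonneg _))
  have h4 := diameter_sq_le_of_chunkiness_le hK hi hγ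
  have h5 := volume_mul_norm_sq_le_integral (convex_hull K) (isCompact_hull K) g hv
  -- In the plane the squared diameter is comparable to the area, so no power of `diameter K`
  -- remains; 256 = 4 · 64.
  calc (w x - w y) ^ 2 = ‖w x - w y‖ ^ 2 := by rw [Real.norm_eq_abs, sq_abs]
    _ ≤ (‖g v‖ * diameter K) ^ 2 := pow_le_pow_left₀ (norm_nonneg _) h3 2
    _ = ‖g v‖ ^ 2 * diameter K ^ 2 := by ring
    _ ≤ ‖g v‖ ^ 2 * (4 * γ ^ 2 * volume.real (interior (hull K))) :=
      mul_le_mul_of_nonneg_left h4 (by positivity)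
    _ = 4 * γ ^ 2 * (volume.real (interior (hull K)) * ‖g v‖ ^ 2) := by ring
    _ ≤ 4 * γ ^ 2 * (64 * ∫ z in interior (hull K), ‖g z‖ ^ 2) :=
      mul_le_mul_of_nonneg_left h5 (by positivity)
    _ = _ := by ring


/-! ### Continuous representatives on a triangle -/

/-- Continuous functions that agree almost everywhere on an open set agree on it, and the interior
of a triangle is dense in it. This identifies the arbitrary choice in `restr`. -/
theorem RestrictsTo.eqOn {Ω : Set Plane} {f p q : Plane → ℝ} {K : Finset Plane}
    (hΩ : interior (hull K) ⊆ Ω) (hne : (interior (hull K)).Nonempty)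
    (hp : RestrictsTo Ω f K p) (hq : RestrictsTo Ω f K q)
    (hpc : ContinuousOn p (hull K)) (hqc : ContinuousOn q (hull K)) :
    Set.EqOn p q (hull K) := by
  have hcl : hull K ⊆ closure (interior (hull K)) := by
    rw [(convex_hull K).closure_interior_eq_closure_of_nonempty_interior hne]
    exact subset_closure
  have hae : p =ᵐ[volume.restrict (interior (hull K))] q := by
    have h1 := ae_restrict_of_ae_restrict_of_subset hΩ hp
    have h2 := ae_restrict_of_ae_restrict_of_subset hΩ hq
    filter_upwards [h1, h2, ae_restrict_mem isOpen_interior.measurableSet] with x h1 h2 hx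
    rw [← h1 (interior_subset hx), ← h2 (interior_subset hx)]
  have hint := Measure.eqOn_open_of_ae_eq hae isOpen_interior (hpc.mono interior_subset)
    (hqc.mono interior_subset)
  exact hint.of_subset_closure hpc hqc interior_subset hcl

theorem restr_eqOn {Ω : Set Plane} {f p : Plane → ℝ} {K : Finset Plane}
    (hΩ : interior (hull K) ⊆ Ω) (hne : (interior (hull K)).Nonempty)
    (hp : RestrictsTo Ω f K p) (hpc : ContinuousOn p (hull K)) :
    Set.EqOn (restr Ω f K) p (hull K) := by
  have h : ∃ p, ContinuousOn p (hull K) ∧ RestrictsTo Ω f K p := ⟨p, hpc, hp⟩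
  rw [restr, dif_pos h]
  exact h.choose_spec.2.eqOn hΩ hne hp h.choose_spec.1 hpc

/-- The gradient is local, so it does not matter that `restr` is undetermined off the triangle. -/
theorem h1SeminormSq_eq {Ω : Set Plane} {f p : Plane → ℝ} {K : Finset Plane}
    (hΩ : interior (hull K) ⊆ Ω) (hne : (interior (hull K)).Nonempty)
    (hp : RestrictsTo Ω f K p) (hpc : ContinuousOn p (hull K)) :
    h1SeminormSq Ω f K = ∫ x in interior (hull K), ‖gradient p x‖ ^ 2 := by
  refine setIntegral_congr_fun isOpen_interior.measurableSet fun x hx => ?_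
  have : restr Ω f K =ᶠ[nhds x] p := by
    filter_upwards [isOpen_interior.mem_nhds hx] with y hy
    exact restr_eqOn hΩ hne hp hpc (interior_subset hy)
  simp only [this.gradient_eq]

/-! ### The space D_K^2 -/

theorem span_refBasis_induction {P : (Plane → ℝ) → Prop} (hadd : ∀ φ ψ, P φ → P ψ → P (φ + ψ))
    (hsmul : ∀ (c : ℝ) φ, P φ → P (c • φ)) (hbasis : ∀ i, P (refBasis i)) {φ : Plane → ℝ}
    (hφ : φ ∈ Submodule.span ℝ (Set.range refBasis)) : P φ := by
  induction hφ using Submodule.span_induction with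
  | mem φ h => obtain ⟨i, rfl⟩ := h; exact hbasis i
  | zero => simpa using hsmul 0 _ (hbasis 0)
  | add φ ψ _ _ h1 h2 => exact hadd _ _ h1 h2
  | smul c φ _ h => exact hsmul c _ h

/-- The functions of `D_K^2` vanish at the midpoint of an edge. -/
theorem eq_zero_of_mem_quadraticBumps {b : Fin 3 → Plane} {q : Plane → ℝ}
    (hq : q ∈ quadraticBumps b) : q ((2⁻¹ : ℝ) • (b 0 + b 1)) = 0 := by
  -- This midpoint is the image of (1/2, 0), where each basis function has a vanishing factor. One
  -- edge suffices, since `V2` allows every ordering of the vertices.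
  have hm : (2⁻¹ : ℝ) • (b 0 + b 1) = refMap b !₂[2⁻¹, 0] := by
    ext i
    simp [refMap]
    ring
  have h : (q ∘ refMap b) !₂[2⁻¹, 0] = 0 := by
    refine span_refBasis_induction (P := fun φ => φ !₂[2⁻¹, 0] = 0) ?_ ?_ ?_ hq
    · intro φ ψ h1 h2
      simp [h1, h2]
    · intro c φ h
      simp [h]
    · intro i
      fin_cases i <;> norm_num [refBasis]
  rw [hm]
  exact h

/-- The barycentric coordinates 1 and 2 invert `refMap b`, so each basis function pulls back to a
product of two affine functions. -/
theorem hasAffineGradient_of_mem_quadraticBumps {b : Fin 3 → Plane}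
    (hb : AffineIndependent ℝ b) {q : Plane → ℝ} (hq : q ∈ quadraticBumps b) :
    HasAffineGradient q := by
  have htop : affineSpan ℝ (Set.range b) = ⊤ :=
    hb.affineSpan_eq_top_iff_card_eq_finrank_add_one.2 (by simp)
  let B : AffineBasis (Fin 3) ℝ Plane := ⟨b, hb, htop⟩
  have hB : ∀ i, B i = b i := fun _ => rfl
  have hF : ∀ x, refMap b !₂[B.coord 1 x, B.coord 2 x] = x := by
    intro x
    have h1 := B.linear_combination_coord_eq_self x
    have h2 := B.sum_coord_apply_eq_one x
    rw [Fin.sum_univ_three] at h1 h2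
    simp only [hB] at h1
    have h0 : B.coord 0 x = 1 - B.coord 1 x - B.coord 2 x := by linarith
    rw [h0] at h1
    conv_rhs => rw [← h1]
    simp only [refMap]
    ext i
    simp
    ring
  have hq' : q = fun x => (q ∘ refMap b) !₂[B.coord 1 x, B.coord 2 x] := by
    ext x
    simp [hF]
  rw [hq']
  refine span_refBasis_induction
    (P := fun φ => HasAffineGradient fun x => φ !₂[B.coord 1 x, B.coord 2 x]) ?_ ?_ ?_ hq
  · exact fun φ ψ h1 h2 => h1.add h2
  · exact fun c φ h => h.const_smul c
  · intro i
    fin_cases i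
    · convert hasAffineGradient_mul_affineMap
        (AffineMap.const ℝ Plane (-1 : ℝ) + (2 : ℝ) • B.coord 1 + (2 : ℝ) • B.coord 2)
        (AffineMap.const ℝ Plane (-1 : ℝ) + B.coord 1 + B.coord 2) using 2 with x
      simp [refBasis]
    · convert hasAffineGradient_mul_affineMap
        ((2 : ℝ) • B.coord 1 - AffineMap.const ℝ Plane (1 : ℝ)) (B.coord 1) using 2 with x
      simp [refBasis]
    · convert hasAffineGradient_mul_affineMap
        ((2 : ℝ) • B.coord 2 - AffineMap.const ℝ Plane (1 : ℝ)) (B.coord 2) using 2 with x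
      simp [refBasis]

/-! ### Normals and sides of an edge -/

/-- A line in the plane has a unit normal, and the vectors orthogonal to that normal span the
line. -/
theorem exists_unit_normal {d : Plane} (hd : d ≠ 0) :
    ∃ u : Plane, ‖u‖ = 1 ∧ inner ℝ u d = 0 ∧ ∀ v : Plane, inner ℝ u v = 0 → ∃ c : ℝ, v = c • d := by
  -- `d` turned by a right angle. The coefficient `c` below is that of the orthogonal projection of
  -- `v` onto `d`.
  set j : Plane := !₂[-d 1, d 0] with hj
  have hjd : ‖j‖ ^ 2 = d 0 ^ 2 + d 1 ^ 2 := by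
    rw [EuclideanSpace.norm_sq_eq, Fin.sum_univ_two]
    simp [hj]
    ring
  have hpos : 0 < d 0 ^ 2 + d 1 ^ 2 := by
    have : 0 < ‖d‖ ^ 2 := by positivity
    rw [EuclideanSpace.norm_sq_eq, Fin.sum_univ_two] at this
    simpa using this
  have hj0 : ‖j‖ ≠ 0 := by
    intro h
    rw [h] at hjd
    linarith
  refine ⟨‖j‖⁻¹ • j, ?_, ?_, fun v hv => ⟨(v 0 * d 0 + v 1 * d 1) / (d 0 ^ 2 + d 1 ^ 2), ?_⟩⟩
  · rw [norm_smul, norm_inv, norm_norm, inv_mul_cancel₀ hj0]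
  · rw [inner_smul_left]
    simp [hj, PiLp.inner_apply, Fin.sum_univ_two]
    right
    ring
  · have hv' : v 1 * d 0 = v 0 * d 1 := by
      rw [inner_smul_left] at hv
      have := (mul_eq_zero.1 hv).resolve_left (by simpa using hj0)
      simp [hj, PiLp.inner_apply, Fin.sum_univ_two] at this
      linarith
    ext i
    fin_cases i
    · simp
      field_simp
      linear_combination (- d 1) * hv'
    · simp
      field_simp
      linear_combination (d 0) * hv'

/-- The part of `n` orthogonal to `u` is a multiple of `d`; it is also orthogonal to `d`, hence
zero. -/
theorem eq_inner_smul_of_inner_eq_zero {d u n : Plane} (hd : d ≠ 0) (hu : ‖u‖ = 1)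
    (hud : inner ℝ u d = 0) (hspan : ∀ v : Plane, inner ℝ u v = 0 → ∃ c : ℝ, v = c • d)
    (hn : inner ℝ n d = 0) : n = inner ℝ u n • u := by
  obtain ⟨c, hc⟩ := hspan (n - inner ℝ u n • u) (by
    rw [inner_sub_right, inner_smul_right, real_inner_self_eq_norm_sq, hu]
    ring)
  have h : inner ℝ (n - inner ℝ u n • u) d = 0 := by
    rw [inner_sub_left, inner_smul_left, hn, hud]
    simp
  rw [hc, inner_smul_left, real_inner_self_eq_norm_sq] at h
  have hc0 : c = 0 := by simpa [hd] using h
  rw [hc0, zero_smul] at hc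
  exact sub_eq_zero.1 hc

/-- The outward normal of the edge `e` of the triangle `insert z e`, in terms of a unit normal `u`
of `e`. -/
theorem outwardNormal_insert {x y z u : Plane} {e : Finset Plane} (he : e = {x, y}) (hxy : x ≠ y)
    (hz : z ∉ e) (hu : ‖u‖ = 1) (hud : inner ℝ u (y - x) = 0)
    (hspan : ∀ v : Plane, inner ℝ u v = 0 → ∃ c : ℝ, v = c • (y - x))
    (huz : inner ℝ u (z - x) < 0) : outwardNormal (insert z e) e = u := by
  have hdiff : insert z e \ e = {z} := by
    rw [Finset.insert_sdiff_of_notMem _ hz]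
    simp
  have hux : inner ℝ u (x - y) = 0 := by
    rw [← neg_sub, inner_neg_right, hud, neg_zero]
  -- Existence makes the `Classical.epsilon` choice an outward normal as well. It is then `u` or
  -- `-u`, and the sign condition at `z` excludes `-u`.
  have hex : IsOutwardNormal (insert z e) e u := by
    refine ⟨hu, fun p hp q hq => ?_, fun p hp q hq => ?_⟩
    · rw [he] at hp hq
      simp only [Finset.mem_insert, Finset.mem_singleton] at hp hq
      rcases hp with rfl | rfl <;> rcases hq with rfl | rfl <;> simp [hud, hux]
    · rw [hdiff, Finset.mem_singleton] at hq
      rw [he] at hp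
      simp only [Finset.mem_insert, Finset.mem_singleton] at hp
      rcases hp with rfl | rfl
      · rwa [hq]
      · have : q - p = (z - x) + (x - p) := by rw [hq]; abel
        rw [this, inner_add_right, hux, add_zero]
        exact huz
  obtain ⟨h1, h2, h3⟩ : IsOutwardNormal (insert z e) e (outwardNormal (insert z e) e) :=
    Classical.epsilon_spec (p := IsOutwardNormal (insert z e) e) ⟨u, hex⟩
  set n := outwardNormal (insert z e) e
  have hxe : x ∈ e := by simp [he]
  have hye : y ∈ e := by simp [he]
  have hn := eq_inner_smul_of_inner_eq_zero (sub_ne_zero.2 hxy.symm) hu hud hspan (h2 x hxe y hye)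
  have hneg := h3 x hxe z (by simp [hdiff])
  have habs : |inner ℝ u n| = 1 := by
    have := congrArg norm hn
    rwa [h1, norm_smul, hu, mul_one, Real.norm_eq_abs, eq_comm] at this
  rcases (abs_eq zero_le_one).1 habs with h | h
  · rw [hn, h, one_smul]
  · rw [hn, h, neg_smul, one_smul, inner_neg_left] at hneg
    linarith

/-- Two triangles `insert z e` and `insert z' e` that meet in the edge `e` only lie on different
sides of `e`. -/
theorem inner_nonneg_of_hull_inter_subset {x y z z' u : Plane} {e : Finset Plane} (he : e = {x, y})
    (hud : inner ℝ u (y - x) = 0)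
    (hspan : ∀ v : Plane, inner ℝ u v = 0 → ∃ c : ℝ, v = c • (y - x))
    (hinter : hull (insert z e) ∩ hull (insert z' e) ⊆ hull e)
    (hz : inner ℝ u (z - x) < 0) : 0 ≤ inner ℝ u (z' - x) := by
  by_contra! hz'
  -- If `z` and `z'` were on the same side, then z = x + δ(z' - x) + β(y - x) with δ > 0. The
  -- midpoint of `e`, moved slightly towards `z`, would lie in both triangles but off the line
  -- through `e`. The `ε` below is small enough for its barycentric coordinates with respect to `x`,
  -- `y`, `z'` to be nonnegative.
  set δ := inner ℝ u (z - x) / inner ℝ u (z' - x) with hδ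
  have hδ0 : 0 < δ := div_pos_of_neg_of_neg hz hz'
  obtain ⟨β, hβ⟩ := hspan (z - x - δ • (z' - x)) (by
    rw [inner_sub_right, inner_smul_right, hδ, div_mul_cancel₀ _ hz'.ne, sub_self])
  obtain ⟨ε, hε0, hε1, hε2, hε3⟩ : ∃ ε : ℝ, 0 < ε ∧ ε ≤ 1 ∧
      0 ≤ (1 - ε) / 2 + ε * (1 - β - δ) ∧ 0 ≤ (1 - ε) / 2 + ε * β := by
    have hM : 0 < 3 + 2 * |β| + 2 * δ := by positivity
    have hεM : (3 + 2 * |β| + 2 * δ)⁻¹ * (3 + 2 * |β| + 2 * δ) = 1 := inv_mul_cancel₀ hM.ne'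
    have hε : 0 < (3 + 2 * |β| + 2 * δ)⁻¹ := inv_pos.2 hM
    set ε := (3 + 2 * |β| + 2 * δ)⁻¹
    refine ⟨ε, hε, ?_, ?_, ?_⟩
    · nlinarith [abs_nonneg β]
    · nlinarith [mul_nonneg hε.le (sub_nonneg.2 (le_abs_self β))]
    · nlinarith [mul_nonneg hε.le (sub_nonneg.2 (neg_abs_le β)), abs_nonneg β,
        mul_pos hε hδ0, mul_nonneg hε.le (abs_nonneg β)]
  set p : Plane := ((1 - ε) / 2) • x + ((1 - ε) / 2) • y + ε • z with hp
  have hxK : ∀ t, x ∈ hull (insert t e) := fun t => subset_convexHull ℝ _ (by simp [he])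
  have hyK : ∀ t, y ∈ hull (insert t e) := fun t => subset_convexHull ℝ _ (by simp [he])
  have htK : ∀ t, t ∈ hull (insert t e) := fun t => subset_convexHull ℝ _ (by simp)
  have hpK : p ∈ hull (insert z e) := by
    refine (convex_hull _).sum_mem (t := Finset.univ) (w := ![(1 - ε) / 2, (1 - ε) / 2, ε])
      (z := ![x, y, z]) ?_ ?_ ?_ |> fun h => by simpa [Fin.sum_univ_three] using h
    · intro i _
      fin_cases i <;> simp <;> linarith
    · simp [Fin.sum_univ_three]
    · intro i _
      fin_cases i
      exacts [hxK z, hyK z, htK z]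
  have hpK' : p ∈ hull (insert z' e) := by
    have hpe : p = ((1 - ε) / 2 + ε * (1 - β - δ)) • x + ((1 - ε) / 2 + ε * β) • y +
        (ε * δ) • z' := by
      have hzeq : z = x + δ • (z' - x) + β • (y - x) := by
        rw [← hβ]
        abel
      rw [hp, hzeq]
      module
    rw [hpe]
    refine (convex_hull _).sum_mem (t := Finset.univ)
      (w := ![(1 - ε) / 2 + ε * (1 - β - δ), (1 - ε) / 2 + ε * β, ε * δ])
      (z := ![x, y, z']) ?_ ?_ ?_ |> fun h => by simpa [Fin.sum_univ_three] using h
    · intro i _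
      fin_cases i
      exacts [hε2, hε3, (mul_pos hε0 hδ0).le]
    · simp [Fin.sum_univ_three]
      ring
    · intro i _
      fin_cases i
      exacts [hxK z', hyK z', htK z']
  have hpe := hinter ⟨hpK, hpK'⟩
  rw [hull, he, Finset.coe_pair, convexHull_pair, segment_eq_image'] at hpe
  obtain ⟨θ, -, hθ⟩ := hpe
  have h0 : inner ℝ u (p - x) = 0 := by
    rw [← hθ, add_sub_cancel_left, inner_smul_right, hud, mul_zero]
  have h1 : p - x = ((1 - ε) / 2) • (y - x) + ε • (z - x) := by
    rw [hp]
    module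
  rw [h1, inner_add_right, inner_smul_right, inner_smul_right, hud, mul_zero, zero_add] at h0
  nlinarith


/-! ### Midpoints and lengths of edges -/

theorem edgeMidpoint_pair {x y : Plane} (hxy : x ≠ y) :
    edgeMidpoint {x, y} = (2⁻¹ : ℝ) • (x + y) := by
  rw [edgeMidpoint, Finset.sum_pair hxy]

theorem hull_pair (x y : Plane) : hull {x, y} = segment ℝ x y := by
  rw [hull, Finset.coe_pair, convexHull_pair]

theorem hull_mono {s t : Finset Plane} (h : s ⊆ t) : hull s ⊆ hull t :=
  convexHull_mono (Finset.coe_subset.2 h)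

theorem edgeMidpoint_mem_hull {e : Finset Plane} (he : e.card = 2) : edgeMidpoint e ∈ hull e := by
  obtain ⟨x, y, hxy, rfl⟩ := Finset.card_eq_two.1 he
  rw [edgeMidpoint_pair hxy, hull_pair]
  exact ⟨2⁻¹, 2⁻¹, by norm_num, by norm_num, by norm_num, by rw [smul_add]⟩

theorem hausdorffMeasure_hull_lt_top {e : Finset Plane} (he : e.card = 2) :
    (Measure.hausdorffMeasure 1 : Measure Plane) (hull e) < ⊤ := by
  obtain ⟨x, y, hxy, rfl⟩ := Finset.card_eq_two.1 he
  rw [hull_pair, hausdorffMeasure_segment]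
  exact edist_lt_top x y

theorem edgeLength_le_diameter {e K : Finset Plane} (he : e.card = 2) (heK : e ⊆ K) :
    edgeLength e ≤ diameter K := by
  obtain ⟨x, y, hxy, rfl⟩ := Finset.card_eq_two.1 he
  rw [edgeLength, hull_pair, measureReal_def, hausdorffMeasure_segment, ← dist_edist]
  exact Metric.dist_le_diam_of_mem (isCompact_hull K).isBounded
    (subset_convexHull ℝ _ (heK (by simp))) (subset_convexHull ℝ _ (heK (by simp)))

theorem h1SeminormSq_nonneg (Ω : Set Plane) (f : Plane → ℝ) (K : Finset Plane) :
    0 ≤ h1SeminormSq Ω f K :=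
  integral_nonneg fun _ => by positivity

theorem affineIndependent_of_injective_of_forall_mem {ι : Type*} {b : ι → Plane}
    {K : Finset Plane} (hi : AffineIndependent ℝ ((↑) : K → Plane)) (hb : Function.Injective b)
    (hmem : ∀ i, b i ∈ K) : AffineIndependent ℝ b := by
  let f : ι ↪ K := ⟨fun i => ⟨b i, hmem i⟩, fun i j h => hb (Subtype.ext_iff.1 h)⟩
  exact hi.comp_embedding f

theorem affineIndependent_vertices {x y z : Plane} (hxy : x ≠ y) (hzx : z ≠ x) (hzy : z ≠ y)
    (hi : AffineIndependent ℝ ((↑) : ({z, x, y} : Finset Plane) → Plane)) :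
    AffineIndependent ℝ ![x, y, z] := by
  have hinj : Function.Injective ![x, y, z] := by
    simp [Function.Injective, Fin.forall_fin_succ, hxy, hzx, hzy, hxy.symm, hzx.symm, hzy.symm]
  refine affineIndependent_of_injective_of_forall_mem hi hinj fun i => ?_
  fin_cases i <;> simp

/-! ### Triangles that share an edge -/

namespace Triangulation

variable {Ω : Set Plane} (T : Triangulation Ω)

theorem mem_triangles {K : Finset Plane} :
    K ∈ T.triangles ↔ K ∈ T.complex.faces ∧ K.card = 3 := by
  simp [triangles]

theorem mem_edges {e : Finset Plane} : e ∈ T.edges ↔ e ∈ T.complex.faces ∧ e.card = 2 := by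
  simp [edges]

theorem mem_trianglesAt {K e : Finset Plane} :
    K ∈ T.trianglesAt e ↔ K ∈ T.triangles ∧ e ⊆ K := by
  simp [trianglesAt]

theorem interior_hull_subset {K : Finset Plane} (hK : K ∈ T.triangles) :
    interior (hull K) ⊆ Ω := by
  rw [← T.fills]
  exact interior_mono
    (Geometry.SimplicialComplex.convexHull_subset_space (T.mem_triangles.1 hK).1)

theorem affineIndependent {K : Finset Plane} (hK : K ∈ T.triangles) :
    AffineIndependent ℝ ((↑) : K → Plane) :=
  T.complex.indep (T.mem_triangles.1 hK).1

theorem exists_eq_insert {K e : Finset Plane} (he : e ∈ T.edges) (hK : K ∈ T.trianglesAt e) :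
    ∃ z ∉ e, insert z e = K := by
  obtain ⟨hK, heK⟩ := T.mem_trianglesAt.1 hK
  exact Finset.exists_eq_insert_iff.2 ⟨heK, by rw [(T.mem_edges.1 he).2, (T.mem_triangles.1 hK).2]⟩

/-- The opposite vertex of a triangle does not lie on the line through an edge. -/
theorem inner_ne_zero {x y z u : Plane} (hxy : x ≠ y) (hz : z ∉ ({x, y} : Finset Plane))
    (hK : insert z {x, y} ∈ T.triangles)
    (hspan : ∀ v : Plane, inner ℝ u v = 0 → ∃ c : ℝ, v = c • (y - x)) :
    inner ℝ u (z - x) ≠ 0 := by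
  intro h
  obtain ⟨c, hc⟩ := hspan _ h
  simp only [Finset.mem_insert, Finset.mem_singleton, not_or] at hz
  have hind := affineIndependent_vertices hxy hz.1 hz.2 (T.affineIndependent hK)
  rw [affineIndependent_iff_not_collinear_set] at hind
  refine hind ((collinear_iff_of_mem (p₀ := x) (by simp)).2 ⟨y - x, fun p hp => ?_⟩)
  simp only [Set.mem_insert_iff, Set.mem_singleton_iff] at hp
  rcases hp with rfl | rfl | rfl
  · exact ⟨0, by simp⟩
  · exact ⟨1, by simp⟩
  · exact ⟨c, by rw [← hc]; simp⟩

/-- Faces of a simplicial complex meet in the hull of their common vertices, which here all belong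
to `e`. -/
theorem hull_inter_subset {e : Finset Plane} {z z' : Plane} (hz : z ∉ e) (hzz : z ≠ z')
    (hK : insert z e ∈ T.triangles) (hK' : insert z' e ∈ T.triangles) :
    hull (insert z e) ∩ hull (insert z' e) ⊆ hull e := by
  refine (T.complex.inter_subset_convexHull (T.mem_triangles.1 hK).1
    (T.mem_triangles.1 hK').1).trans (convexHull_mono ?_)
  rintro p ⟨hp, hp'⟩
  simp only [Finset.coe_insert, Set.mem_insert_iff, Finset.mem_coe] at hp hp' ⊢
  rcases hp with rfl | hp
  · exact hp'.resolve_left hzz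
  · exact hp

/-- A unit normal of an edge distinguishes the triangles at the edge: up to sign it is their outward
normal, with different signs for different triangles. -/
theorem exists_side {e : Finset Plane} (he : e ∈ T.edges) :
    ∃ (u : Plane) (s : Finset Plane → Prop), ‖u‖ = 1 ∧
      (∀ K ∈ T.trianglesAt e, s K → outwardNormal K e = u) ∧
      (∀ K ∈ T.trianglesAt e, ¬ s K → outwardNormal K e = -u) ∧
      ∀ K ∈ T.trianglesAt e, ∀ K' ∈ T.trianglesAt e, K ≠ K' → (s K ↔ ¬ s K') := by
  obtain ⟨x, y, hxy, rfl⟩ := Finset.card_eq_two.1 (T.mem_edges.1 he).2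
  obtain ⟨u, hu, hud, hspan⟩ := exists_unit_normal (sub_ne_zero.2 hxy.symm)
  have hspan' : ∀ v : Plane, inner ℝ (-u) v = 0 → ∃ c : ℝ, v = c • (y - x) := fun v hv =>
    hspan v (by simpa using hv)
  have hpos : ∀ z ∉ ({x, y} : Finset Plane), insert z {x, y} ∈ T.triangles →
      ¬ inner ℝ u (z - x) < 0 → inner ℝ (-u) (z - x) < 0 := by
    intro z hz hK h
    rw [inner_neg_left, neg_lt_zero]
    exact lt_of_le_of_ne (not_lt.1 h) (T.inner_ne_zero hxy hz hK hspan).symm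
  have hside : ∀ z ∉ ({x, y} : Finset Plane), insert z {x, y} ∈ T.triangles →
      ((∃ t ∈ insert z ({x, y} : Finset Plane), inner ℝ u (t - x) < 0) ↔
        inner ℝ u (z - x) < 0) := by
    intro z hz hK
    refine ⟨?_, fun h => ⟨z, by simp, h⟩⟩
    rintro ⟨t, ht, h⟩
    simp only [Finset.mem_insert, Finset.mem_singleton] at ht
    rcases ht with rfl | rfl | rfl
    · exact h
    · simp at h
    · exact absurd h (by rw [hud]; exact lt_irrefl _)
  -- The endpoints of `e` have inner product zero, so only the opposite vertex can witness this
  -- predicate; it names a side without choosing that vertex.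
  refine ⟨u, fun K => ∃ t ∈ K, inner ℝ u (t - x) < 0, hu, ?_, ?_, ?_⟩
  · intro K hK h
    obtain ⟨z, hz, rfl⟩ := T.exists_eq_insert he hK
    rw [hside z hz (T.mem_trianglesAt.1 hK).1] at h
    exact outwardNormal_insert rfl hxy hz hu hud hspan h
  · intro K hK h
    obtain ⟨z, hz, rfl⟩ := T.exists_eq_insert he hK
    replace h := fun h' => h ((hside z hz (T.mem_trianglesAt.1 hK).1).2 h')
    exact outwardNormal_insert rfl hxy hz (by simpa using hu) (by simpa using hud) hspan'
      (hpos z hz (T.mem_trianglesAt.1 hK).1 h)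
  · intro K hK K' hK' hne
    obtain ⟨z, hz, rfl⟩ := T.exists_eq_insert he hK
    obtain ⟨z', hz', rfl⟩ := T.exists_eq_insert he hK'
    have hzz : z ≠ z' := fun h => hne (by rw [h])
    have hT := (T.mem_trianglesAt.1 hK).1
    have hT' := (T.mem_trianglesAt.1 hK').1
    have hinter := T.hull_inter_subset hz hzz hT hT'
    dsimp only
    rw [hside z hz hT, hside z' hz' hT']
    constructor
    · exact fun h => not_lt.2 (inner_nonneg_of_hull_inter_subset rfl hud hspan hinter h)
    · intro h
      -- Both triangles would lie on the positive side of `u`, which is the negative side of `-u`.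
      by_contra h2
      have h3 := inner_nonneg_of_hull_inter_subset rfl (by simpa using hud) hspan' hinter
        (hpos z hz hT h2)
      exact absurd (hpos z' hz' hT' h) (not_lt.2 h3)

theorem outwardNormal_add_outwardNormal {K K' e : Finset Plane} (he : e ∈ T.edges)
    (hK : K ∈ T.trianglesAt e) (hK' : K' ∈ T.trianglesAt e) (hne : K ≠ K') :
    outwardNormal K e + outwardNormal K' e = 0 := by
  obtain ⟨u, s, -, hp, hn, hs⟩ := T.exists_side he
  have h := hs K hK K' hK' hne
  by_cases hsK : s K
  · rw [hp K hK hsK, hn K' hK' (h.1 hsK), add_neg_cancel]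
  · rw [hn K hK hsK, hp K' hK' (by tauto), neg_add_cancel]

/-- `pure` provides one triangle. Three would have to lie pairwise on opposite sides of a line,
which has only two. -/
theorem card_trianglesAt {e : Finset Plane} (he : e ∈ T.edges) :
    (T.trianglesAt e).card = 1 ∨ (T.trianglesAt e).card = 2 := by
  have hpos : 0 < (T.trianglesAt e).card := by
    obtain ⟨K, hK, heK, h3⟩ := T.pure e (T.mem_edges.1 he).1
    exact Finset.card_pos.2 ⟨K, T.mem_trianglesAt.2 ⟨T.mem_triangles.2 ⟨hK, h3⟩, heK⟩⟩
  have hle : (T.trianglesAt e).card ≤ 2 := by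
    by_contra! h
    obtain ⟨K₁, h1, K₂, h2, K₃, h3, h12, h13, h23⟩ := Finset.two_lt_card.1 h
    obtain ⟨u, s, -, -, -, hs⟩ := T.exists_side he
    have := hs _ h1 _ h2 h12
    have := hs _ h1 _ h3 h13
    have := hs _ h2 _ h3 h23
    tauto
  omega

/-! ### Traces and the jump estimate -/

/-- The traces on `e` of the restriction to `K` of a function of the NC1-C2 space: its value at the
midpoint is that of the affine part, and its oscillation is bounded by the `H¹` seminorm. -/
theorem restr_add_midpoint_and_sq_sub_le {γ : ℝ} {K e : Finset Plane} (he : e ∈ T.edges)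
    (hK : K ∈ T.trianglesAt e) (hγ : chunkiness K ≤ γ) {v z : Lp ℝ 2 (volume.restrict Ω)}
    {a : Plane →ᵃ[ℝ] ℝ} (hv : RestrictsTo Ω v K a) (hz : z ∈ T.V2) :
    restr Ω (v + z : Lp ℝ 2 (volume.restrict Ω)) K (edgeMidpoint e) = a (edgeMidpoint e) ∧
    ∀ x ∈ hull e, (restr Ω (v + z : Lp ℝ 2 (volume.restrict Ω)) K x -
        restr Ω (v + z : Lp ℝ 2 (volume.restrict Ω)) K (edgeMidpoint e)) ^ 2 ≤
      256 * γ ^ 2 * h1SeminormSq Ω (v + z : Lp ℝ 2 (volume.restrict Ω)) K := by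
  obtain ⟨hT, heK⟩ := T.mem_trianglesAt.1 hK
  have he2 := (T.mem_edges.1 he).2
  have hK3 := (T.mem_triangles.1 hT).2
  have hi := T.affineIndependent hT
  have hm : edgeMidpoint e ∈ hull K := hull_mono heK (edgeMidpoint_mem_hull he2)
  obtain ⟨q, hq, hqm, hqr⟩ : ∃ q : Plane → ℝ, HasAffineGradient q ∧ q (edgeMidpoint e) = 0 ∧
      RestrictsTo Ω z K q := by
    obtain ⟨t, ht, rfl⟩ := T.exists_eq_insert he hK
    obtain ⟨x, y, hxy, rfl⟩ := Finset.card_eq_two.1 he2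
    simp only [Finset.mem_insert, Finset.mem_singleton, not_or] at ht
    -- The endpoints of `e` come first in the ordering, as `eq_zero_of_mem_quadraticBumps` concerns
    -- the edge from `b 0` to `b 1`.
    obtain ⟨q, hq, hqr⟩ := hz _ hT ![x, y, t] (by
      ext p
      simp [Set.mem_insert_iff]
      tauto)
    refine ⟨q, hasAffineGradient_of_mem_quadraticBumps
      (affineIndependent_vertices hxy ht.1 ht.2 hi) hq, ?_, hqr⟩
    rw [edgeMidpoint_pair hxy]
    exact eq_zero_of_mem_quadraticBumps hq
  have hw : HasAffineGradient (a + q) := (hasAffineGradient_affineMap a).add hq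
  have hwr : RestrictsTo Ω (v + z : Lp ℝ 2 (volume.restrict Ω)) K (a + q) := by
    filter_upwards [Lp.coeFn_add v z, hv, hqr] with x hx h1 h2 hxK
    rw [hx, Pi.add_apply, h1 hxK, h2 hxK, Pi.add_apply]
  have hΩ := T.interior_hull_subset hT
  have hne := interior_hull_nonempty hK3 hi
  have heq := restr_eqOn hΩ hne hwr hw.continuous.continuousOn
  refine ⟨by rw [heq hm]; simp [hqm], fun x hx => ?_⟩
  rw [heq hm, heq (hull_mono heK hx), h1SeminormSq_eq hΩ hne hwr hw.continuous.continuousOn]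
  exact sq_sub_le_integral_of_hasAffineGradient hK3 hi hγ hw (hull_mono heK hx) hm

theorem jump_midpoint_eq_zero {e : Finset Plane} (he : e ∈ T.edges) {f : Plane → ℝ}
    (hcont : ∀ K ∈ T.trianglesAt e, ∀ K' ∈ T.trianglesAt e,
      restr Ω f K (edgeMidpoint e) = restr Ω f K' (edgeMidpoint e))
    (hbdry : T.IsBoundaryEdge e → ∀ K ∈ T.trianglesAt e, restr Ω f K (edgeMidpoint e) = 0) :
    T.jump f e (edgeMidpoint e) = 0 := by
  rcases T.card_trianglesAt he with h | h
  · refine Finset.sum_eq_zero fun K hK => ?_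
    rw [hbdry ⟨he, h⟩ K hK, zero_smul]
  · obtain ⟨K, K', hne, hKK⟩ := Finset.card_eq_two.1 h
    have hK : K ∈ T.trianglesAt e := by simp [hKK]
    have hK' : K' ∈ T.trianglesAt e := by simp [hKK]
    rw [jump, hKK, Finset.sum_pair hne, hcont K hK K' hK', ← smul_add,
      T.outwardNormal_add_outwardNormal he hK hK' hne, smul_zero]

theorem norm_outwardNormal {K e : Finset Plane} (he : e ∈ T.edges) (hK : K ∈ T.trianglesAt e) :
    ‖outwardNormal K e‖ = 1 := by
  obtain ⟨u, s, hu, hp, hn, -⟩ := T.exists_side he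
  by_cases hs : s K
  · rw [hp K hK hs, hu]
  · rw [hn K hK hs, norm_neg, hu]

/-- Subtracting the zero jump at the midpoint turns traces into oscillations. The factor 2 is
Cauchy–Schwarz over at most two triangles. Integration gives a second factor |e|, and |e|² ≤ h_K²
supplies the weights. -/
theorem edgeLength_mul_jumpNormSq_le {e : Finset Plane} (he : e ∈ T.edges) {f : Plane → ℝ}
    {c : ℝ} (hc : 0 ≤ c) (hjump : T.jump f e (edgeMidpoint e) = 0)
    (hosc : ∀ K ∈ T.trianglesAt e, ∀ x ∈ hull e,
      (restr Ω f K x - restr Ω f K (edgeMidpoint e)) ^ 2 ≤ c * h1SeminormSq Ω f K) :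
    edgeLength e * T.jumpNormSq f e ≤
      2 * c * ∑ K ∈ T.trianglesAt e, diameter K ^ 2 * h1SeminormSq Ω f K := by
  have he2 := (T.mem_edges.1 he).2
  have hcard : ((T.trianglesAt e).card : ℝ) ≤ 2 := by
    rcases T.card_trianglesAt he with h | h <;> rw [h] <;> norm_num
  have hbound : ∀ x ∈ hull e,
      ‖T.jump f e x‖ ^ 2 ≤ 2 * c * ∑ K ∈ T.trianglesAt e, h1SeminormSq Ω f K := by
    intro x hx
    have h1 : T.jump f e x = ∑ K ∈ T.trianglesAt e,
        (restr Ω f K x - restr Ω f K (edgeMidpoint e)) • outwardNormal K e := by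
      rw [← sub_zero (T.jump f e x), ← hjump]
      simp only [jump, sub_smul, Finset.sum_sub_distrib]
    have h2 : ‖T.jump f e x‖ ≤
        ∑ K ∈ T.trianglesAt e, |restr Ω f K x - restr Ω f K (edgeMidpoint e)| := by
      rw [h1]
      refine norm_sum_le_of_le _ fun K hK => ?_
      rw [norm_smul, T.norm_outwardNormal he hK, mul_one, Real.norm_eq_abs]
    calc ‖T.jump f e x‖ ^ 2
        ≤ (∑ K ∈ T.trianglesAt e, |restr Ω f K x - restr Ω f K (edgeMidpoint e)|) ^ 2 :=
          pow_le_pow_left₀ (norm_nonneg _) h2 2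
      _ ≤ (T.trianglesAt e).card *
          ∑ K ∈ T.trianglesAt e, |restr Ω f K x - restr Ω f K (edgeMidpoint e)| ^ 2 :=
          sq_sum_le_card_mul_sum_sq
      _ ≤ 2 * ∑ K ∈ T.trianglesAt e, c * h1SeminormSq Ω f K := by
          refine mul_le_mul hcard (Finset.sum_le_sum fun K hK => ?_)
            (Finset.sum_nonneg fun K _ => by positivity) zero_le_two
          rw [sq_abs]
          exact hosc K hK x hx
      _ = _ := by rw [← Finset.mul_sum]; ring
  have hL : 0 ≤ edgeLength e := measureReal_nonneg
  have hint : T.jumpNormSq f e ≤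
      (2 * c * ∑ K ∈ T.trianglesAt e, h1SeminormSq Ω f K) * edgeLength e := by
    refine (Real.le_norm_self _).trans (norm_setIntegral_le_of_norm_le_const
      (hausdorffMeasure_hull_lt_top he2) fun x hx => ?_)
    rw [Real.norm_of_nonneg (by positivity)]
    exact hbound x hx
  calc edgeLength e * T.jumpNormSq f e
      ≤ edgeLength e * ((2 * c * ∑ K ∈ T.trianglesAt e, h1SeminormSq Ω f K) * edgeLength e) :=
        mul_le_mul_of_nonneg_left hint hL
    _ = 2 * c * ∑ K ∈ T.trianglesAt e, edgeLength e ^ 2 * h1SeminormSq Ω f K := by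
        rw [← Finset.mul_sum]
        ring
    _ ≤ _ := by
        refine mul_le_mul_of_nonneg_left (Finset.sum_le_sum fun K hK => ?_) (by positivity)
        exact mul_le_mul_of_nonneg_right
          (pow_le_pow_left₀ hL (edgeLength_le_diameter he2 (T.mem_trianglesAt.1 hK).2) 2)
          (h1SeminormSq_nonneg Ω f K)

end Triangulation

end NC1C2

theorem lemma3 (γ : ℝ) :
    ∃ C : ℝ, 0 < C ∧
      ∀ (Ω : Set NC1C2.Plane) (T : NC1C2.Triangulation Ω) (e : Finset NC1C2.Plane), e ∈ T.edges →
        (∀ K ∈ T.trianglesAt e, NC1C2.chunkiness K ≤ γ) →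
        (∀ ω ∈ T.Vh, T.IsInteriorEdge e →
          T.jump ω e (NC1C2.edgeMidpoint e) = 0 ∧
          NC1C2.edgeLength e * T.jumpNormSq ω e ≤
            C * ∑ K ∈ T.trianglesAt e, NC1C2.diameter K ^ 2 * NC1C2.h1SeminormSq Ω ω K) ∧
        (∀ ω ∈ T.VhZero,
          T.jump ω e (NC1C2.edgeMidpoint e) = 0 ∧
          NC1C2.edgeLength e * T.jumpNormSq ω e ≤
            C * ∑ K ∈ T.trianglesAt e, NC1C2.diameter K ^ 2 * NC1C2.h1SeminormSq Ω ω K) := by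
  open NC1C2 in
  -- The summand 1 only keeps the constant positive when `γ = 0`.
  refine ⟨2 * (256 * γ ^ 2 + 1), by positivity, fun Ω T e he hγ => ?_⟩
  -- Covers both cases: the boundary hypothesis is vacuous on an interior edge and holds for
  -- `VhZero`.
  have main : ∀ v ∈ T.V1, ∀ z ∈ T.V2,
      (T.IsBoundaryEdge e → ∀ K ∈ T.trianglesAt e,
        restr Ω (v + z : Lp ℝ 2 (volume.restrict Ω)) K (edgeMidpoint e) = 0) →
      T.jump (v + z : Lp ℝ 2 (volume.restrict Ω)) e (edgeMidpoint e) = 0 ∧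
      edgeLength e * T.jumpNormSq (v + z : Lp ℝ 2 (volume.restrict Ω)) e ≤
        2 * (256 * γ ^ 2 + 1) * ∑ K ∈ T.trianglesAt e,
          diameter K ^ 2 * h1SeminormSq Ω (v + z : Lp ℝ 2 (volume.restrict Ω)) K := by
    rintro v ⟨a, ha, ha'⟩ z hz hbdry
    have hr := fun K hK => T.restr_add_midpoint_and_sq_sub_le he hK (hγ K hK)
      (ha K (T.mem_trianglesAt.1 hK).1) hz
    have hjump := T.jump_midpoint_eq_zero he (fun K hK K' hK' => by
      rw [(hr K hK).1, (hr K' hK').1, ha' e he K hK K' hK']) hbdry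
    refine ⟨hjump, T.edgeLength_mul_jumpNormSq_le he (by positivity) hjump fun K hK x hx => ?_⟩
    refine ((hr K hK).2 x hx).trans (mul_le_mul_of_nonneg_right ?_ (h1SeminormSq_nonneg _ _ _))
    linarith
  constructor
  · intro ω hω hint
    obtain ⟨v, hv, z, hz, rfl⟩ := Submodule.mem_sup.1 hω
    refine main v hv z hz fun hb => ?_
    have h1 := hint.2
    rw [hb.2] at h1
    norm_num at h1
  · intro ω hω
    -- These affine pieces come separately from those in `hv`; both compute the same `restr` at the
    -- midpoint.
    obtain ⟨v, ⟨hv, a, ha, ha'⟩, z, hz, rfl⟩ := Submodule.mem_sup.1 hω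
    refine main v hv z hz fun hb K hK => ?_
    rw [(T.restr_add_midpoint_and_sq_sub_le he hK (hγ K hK)
      (ha K (T.mem_trianglesAt.1 hK).1) hz).1, ha' e hb K hK]
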